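/- Let $U\subseteq\mathbb R^3$ be open, with coordinates $u=(u^1,u^2,u^3)$, let $H_1,H_2,H_3:U\to\mathbb R$ be smooth and nowhere zero, and consider on $U$ the diagonal metric $$ds^2=H_1^2\,(du^1)^2+H_2^2\,(du^2)^2+H_3^2\,(du^3)^2 .$$ The metric is called flat if it is locally isometric to Euclidean space $\mathbb E^3$, i.e. if every point of $U$ has an open neighbourhood $W\subseteq U$ with a smooth map $x:W\to\mathbb E^3$ that pulls the Euclidean metric back to $ds^2$. A Dupin cyclide is a smooth regular parametric surface in $\mathbb E^3$ both of whose principal curvatures are constant along their curvature lines: if $\gamma$ is any smooth regular curve in the parameter domain whose tangent $\gamma'(t)$ is, for each $t$, a principal direction with principal curvature $\kappa(t)$, then $\kappa$ is constant. The metric is called Dupin-cyclidic if it is flat and, for every open $W\subseteq U$ and every smooth $x:W\to\mathbb E^3$ that pulls the Euclidean metric back to $ds^2$, all parametric surfaces $u^i=\mathrm{const}$ ($i=1,2,3$) of $x$ are Dupin cyclides. Then the metric is Dupin-cyclidic if and only if it is flat and its Lamé coefficients satisfy on $U$ the six partial differential equations $$\frac{\partial}{\partial u^j}\left(H_i^{-1}\,\frac{\partial}{\partial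 u^i}\ln |H_j|\right)=0,\qquad i,j\in\{1,2,3\},\ i\neq j .$$ -/

import Mathlib

open scoped ContDiff

noncomputable section

/-- Euclidean three-space. -/
abbrev E3 : Type := EuclideanSpace ℝ (Fin 3)

/-- The partial derivative `∂f/∂uⁱ` at `u`. -/
def partialDeriv {n : ℕ} {F : Type*} [NormedAddCommGroup F] [NormedSpace ℝ F]
    (i : Fin n) (f : (Fin n → ℝ) → F) (u : Fin n → ℝ) : F :=
  fderiv ℝ f u (Pi.single i 1)

/-! ### Parametric surfaces in `E³` -/

/-- A smooth regular parametric surface `σ : D → E³`: the parameter domain is open and the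
differential is injective at every point. -/
def IsRegularSurface (D : Set (Fin 2 → ℝ)) (σ : (Fin 2 → ℝ) → E3) : Prop :=
  IsOpen D ∧ ContDiffOn ℝ ∞ σ D ∧ ∀ p ∈ D, Function.Injective (fderiv ℝ σ p)

/-- The normal vector `σ₁ × σ₂`. -/
def normalVector (σ : (Fin 2 → ℝ) → E3) (p : Fin 2 → ℝ) : E3 :=
  WithLp.toLp 2 (crossProduct (WithLp.ofLp (partialDeriv 0 σ p)) (WithLp.ofLp (partialDeriv 1 σ p)))

/-- The unit normal `(σ₁ × σ₂) / |σ₁ × σ₂|`. -/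
def unitNormal (σ : (Fin 2 → ℝ) → E3) (p : Fin 2 → ℝ) : E3 :=
  ‖normalVector σ p‖⁻¹ • normalVector σ p

/-- The first fundamental form. -/
def firstForm (σ : (Fin 2 → ℝ) → E3) (p v w : Fin 2 → ℝ) : ℝ :=
  inner ℝ (fderiv ℝ σ p v) (fderiv ℝ σ p w)

/-- The second fundamental form. -/
def secondForm (σ : (Fin 2 → ℝ) → E3) (p v w : Fin 2 → ℝ) : ℝ :=
  inner ℝ (unitNormal σ p) (fderiv ℝ (fderiv ℝ σ) p v w)

/-- `v` is a principal direction at `p`, with principal curvature `κ`: a nonzero eigenvector of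
the second fundamental form relative to the first one, with eigenvalue `κ`. -/
def IsPrincipalDirection (σ : (Fin 2 → ℝ) → E3) (p v : Fin 2 → ℝ) (κ : ℝ) : Prop :=
  v ≠ 0 ∧ ∀ w, secondForm σ p v w = κ * firstForm σ p v w

/-- `γ : (a, b) → D` is a curvature line: a smooth regular curve all of whose tangents are
principal directions; `κ t` is the principal curvature in the direction `γ' t`. -/
def IsCurvatureLine (D : Set (Fin 2 → ℝ)) (σ : (Fin 2 → ℝ) → E3) (a b : ℝ)
    (γ : ℝ → Fin 2 → ℝ) (κ : ℝ → ℝ) : Prop :=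
  ContDiffOn ℝ ∞ γ (Set.Ioo a b) ∧
    ∀ t ∈ Set.Ioo a b, γ t ∈ D ∧ IsPrincipalDirection σ (γ t) (deriv γ t) (κ t)

/-- A Dupin cyclide: a regular parametric surface each of whose principal curvatures is constant
along the corresponding curvature lines. -/
def IsDupinCyclide (D : Set (Fin 2 → ℝ)) (σ : (Fin 2 → ℝ) → E3) : Prop :=
  IsRegularSurface D σ ∧
    ∀ (a b : ℝ) (γ : ℝ → Fin 2 → ℝ) (κ : ℝ → ℝ), IsCurvatureLine D σ a b γ κ →
      ∀ s ∈ Set.Ioo a b, ∀ t ∈ Set.Ioo a b, κ s = κ t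

/-! ### Diagonal metrics in dimension three -/

/-- `H₁, H₂, H₃` are the Lamé coefficients of a smooth diagonal metric on the open set `U`. Only
`H i ≠ 0` is required, so that either sign of the root of the metric coefficient is allowed. -/
def IsLameCoefficients (U : Set (Fin 3 → ℝ)) (H : Fin 3 → (Fin 3 → ℝ) → ℝ) : Prop :=
  IsOpen U ∧ ∀ i, ContDiffOn ℝ ∞ (H i) U ∧ ∀ u ∈ U, H i u ≠ 0

/-- The metric `ds² = H₁² (du¹)² + H₂² (du²)² + H₃² (du³)²` at `u`, as a bilinear form. -/
def diagMetric (H : Fin 3 → (Fin 3 → ℝ) → ℝ) (u v w : Fin 3 → ℝ) : ℝ :=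
  ∑ i, H i u ^ 2 * (v i * w i)

/-- `x : W → E³` is a smooth isometric map from `W` with the diagonal metric to `E³`: the
Euclidean metric pulls back to `ds²`. So `u` are orthogonal coordinates in `E³` locally. -/
def IsEuclideanRealization (W : Set (Fin 3 → ℝ)) (H : Fin 3 → (Fin 3 → ℝ) → ℝ)
    (x : (Fin 3 → ℝ) → E3) : Prop :=
  ContDiffOn ℝ ∞ x W ∧
    ∀ u ∈ W, ∀ v w, inner ℝ (fderiv ℝ x u v) (fderiv ℝ x u w) = diagMetric H u v w

/-- The diagonal metric on `U` is flat: locally isometric to Euclidean three-space. -/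
def IsFlatMetric (U : Set (Fin 3 → ℝ)) (H : Fin 3 → (Fin 3 → ℝ) → ℝ) : Prop :=
  ∀ p ∈ U, ∃ W : Set (Fin 3 → ℝ), IsOpen W ∧ p ∈ W ∧ W ⊆ U ∧
    ∃ x : (Fin 3 → ℝ) → E3, IsEuclideanRealization W H x

/-- The parameter domain of the parametric surface `uⁱ = c` in `W`; the parameters are the two
remaining coordinates. -/
def coordSurfaceDomain (W : Set (Fin 3 → ℝ)) (i : Fin 3) (c : ℝ) : Set (Fin 2 → ℝ) :=
  {q | i.insertNth (α := fun _ => ℝ) c q ∈ W}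

/-- The parametric surface `uⁱ = c` of the coordinates `x`. -/
def coordSurface (x : (Fin 3 → ℝ) → E3) (i : Fin 3) (c : ℝ) (q : Fin 2 → ℝ) : E3 :=
  x (i.insertNth (α := fun _ => ℝ) c q)

/-- The diagonal metric on `U` is Dupin-cyclidic: it is flat, and whenever it is realized
(locally) in `E³`, all parametric surfaces `uⁱ = c` are Dupin cyclides. -/
def IsDupinCyclidic (U : Set (Fin 3 → ℝ)) (H : Fin 3 → (Fin 3 → ℝ) → ℝ) : Prop :=
  IsFlatMetric U H ∧
    ∀ (W : Set (Fin 3 → ℝ)) (x : (Fin 3 → ℝ) → E3), IsOpen W → W ⊆ U →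
      IsEuclideanRealization W H x →
        ∀ (i : Fin 3) (c : ℝ), IsDupinCyclide (coordSurfaceDomain W i c) (coordSurface x i c)

end

/-!
Let `x` be a realization with `⟨∂ᵢx, ∂ⱼx⟩ = Hᵢ² δᵢⱼ`. By Dupin's theorem (`inner_second_distinct`)
the mixed products `⟨∂ᵢ∂ⱼx, ∂ₖx⟩` with distinct indices vanish, so both fundamental forms of a
surface `uⁱ = const` are diagonal in the coordinates, and up to the sign of the unit normal its
principal curvatures are `kⱼ = Hᵢ⁻¹ ∂ᵢ ln|Hⱼ|` (`isPrincipalDirection_coordSurface_iff`). The six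
equations therefore say that each `kⱼ` is constant along the `j`-th coordinate curves.

These coordinate curves are curvature lines, so the equations hold for Dupin-cyclidic metrics.

For the converse, away from umbilics every curvature line is a coordinate curve, but umbilics may
form any closed set and there a curvature line may point in any direction. This is controlled by the
Codazzi equation `∂ₖkⱼ = (∂ₖ ln|Hⱼ|) (kₖ - kⱼ)` (`codazzi`), a consequence of the Lamé equations
of the flat metric (`lame_equation`): together with `∂ⱼkⱼ = 0` it makes the derivative of the
curvature along an arbitrary curvature line vanish at each of its points, umbilic or not.
-/

/-! ### Partial derivatives -/

theorem contDiffOn_partialDeriv {n : ℕ} {F : Type*} [NormedAddCommGroup F] [NormedSpace ℝ F]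
    {W : Set (Fin n → ℝ)} (hW : IsOpen W) {f : (Fin n → ℝ) → F} (hf : ContDiffOn ℝ ∞ f W)
    (i : Fin n) : ContDiffOn ℝ ∞ (partialDeriv i f) W :=
  (hf.fderiv_of_isOpen hW (m := ∞) (by simp)).clm_apply contDiffOn_const

theorem ContDiffOn.differentiableAt_of_isOpen {E F : Type*} [NormedAddCommGroup E]
    [NormedSpace ℝ E] [NormedAddCommGroup F] [NormedSpace ℝ F] {W : Set E} {f : E → F}
    (hf : ContDiffOn ℝ ∞ f W) (hW : IsOpen W) {u : E} (hu : u ∈ W) : DifferentiableAt ℝ f u :=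
  (hf.contDiffAt (hW.mem_nhds hu)).differentiableAt (by simp)

theorem partialDeriv_congr {n : ℕ} {F : Type*} [NormedAddCommGroup F] [NormedSpace ℝ F]
    {W : Set (Fin n → ℝ)} (hW : IsOpen W) {f g : (Fin n → ℝ) → F} (h : Set.EqOn f g W)
    {u : Fin n → ℝ} (hu : u ∈ W) (i : Fin n) : partialDeriv i f u = partialDeriv i g u := by
  unfold partialDeriv
  rw [(h.eventuallyEq_of_mem (hW.mem_nhds hu)).fderiv_eq]

theorem fderiv_fderiv_single {n : ℕ} {F : Type*} [NormedAddCommGroup F] [NormedSpace ℝ F]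
    {W : Set (Fin n → ℝ)} (hW : IsOpen W) {f : (Fin n → ℝ) → F} (hf : ContDiffOn ℝ ∞ f W)
    {u : Fin n → ℝ} (hu : u ∈ W) (i j : Fin n) :
    fderiv ℝ (fderiv ℝ f) u (Pi.single i 1) (Pi.single j 1) =
      partialDeriv i (partialDeriv j f) u := by
  have h := (hf.fderiv_of_isOpen hW (m := ∞) (by simp)).differentiableAt_of_isOpen hW hu
  change _ = fderiv ℝ (fun y => fderiv ℝ f y (Pi.single j 1)) u (Pi.single i 1)
  rw [fderiv_clm_apply h (differentiableAt_const _)]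
  simp

theorem partialDeriv_comm {n : ℕ} {F : Type*} [NormedAddCommGroup F] [NormedSpace ℝ F]
    {W : Set (Fin n → ℝ)} (hW : IsOpen W) {f : (Fin n → ℝ) → F} (hf : ContDiffOn ℝ ∞ f W)
    {u : Fin n → ℝ} (hu : u ∈ W) (i j : Fin n) :
    partialDeriv i (partialDeriv j f) u = partialDeriv j (partialDeriv i f) u := by
  have h : IsSymmSndFDerivAt ℝ f u :=
    (hf.contDiffAt (hW.mem_nhds hu)).isSymmSndFDerivAt (by
      simpa using WithTop.coe_le_coe.2 (le_top (a := (2 : ℕ∞))))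
  rw [← fderiv_fderiv_single hW hf hu, ← fderiv_fderiv_single hW hf hu]
  exact h _ _

theorem partialDeriv_mul {n : ℕ} {f g : (Fin n → ℝ) → ℝ} {u : Fin n → ℝ}
    (hf : DifferentiableAt ℝ f u) (hg : DifferentiableAt ℝ g u) (i : Fin n) :
    partialDeriv i (fun y => f y * g y) u =
      f u * partialDeriv i g u + g u * partialDeriv i f u := by
  simp [partialDeriv, fderiv_fun_mul hf hg]

theorem partialDeriv_inv {n : ℕ} {f : (Fin n → ℝ) → ℝ} {u : Fin n → ℝ}
    (hf : DifferentiableAt ℝ f u) (h0 : f u ≠ 0) (i : Fin n) :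
    partialDeriv i (fun y => (f y)⁻¹) u = -partialDeriv i f u / f u ^ 2 := by
  have := (hasDerivAt_inv h0).comp_hasFDerivAt u hf.hasFDerivAt
  simp only [Function.comp_def] at this
  simp [partialDeriv, this.fderiv]; ring

theorem partialDeriv_log {n : ℕ} {f : (Fin n → ℝ) → ℝ} {u : Fin n → ℝ}
    (hf : DifferentiableAt ℝ f u) (h0 : f u ≠ 0) (i : Fin n) :
    partialDeriv i (fun y => Real.log (f y)) u = (f u)⁻¹ * partialDeriv i f u := by
  simp [partialDeriv, fderiv.log hf h0]

theorem partialDeriv_inner {n : ℕ} {F : Type*} [NormedAddCommGroup F] [InnerProductSpace ℝ F]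
    {f g : (Fin n → ℝ) → F} {u : Fin n → ℝ}
    (hf : DifferentiableAt ℝ f u) (hg : DifferentiableAt ℝ g u) (i : Fin n) :
    partialDeriv i (fun y => inner ℝ (f y) (g y)) u =
      inner ℝ (f u) (partialDeriv i g u) + inner ℝ (partialDeriv i f u) (g u) := by
  simp only [partialDeriv]
  exact fderiv_inner_apply ℝ hf hg _

/-! ### Orthogonal coordinates in `E³` -/

/-- Parseval's identity for an orthogonal, not necessarily normalized, frame of `E³`. -/
theorem inner_eq_sum_of_orthogonal_frame {X : Fin 3 → E3} {h : Fin 3 → ℝ} (h0 : ∀ i, h i ≠ 0)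
    (hX : ∀ i j, inner ℝ (X i) (X j) = if i = j then h i ^ 2 else 0) (a b : E3) :
    inner ℝ a b = ∑ l, inner ℝ a (X l) * inner ℝ b (X l) / h l ^ 2 := by
  have hon : Orthonormal ℝ (fun i => (h i)⁻¹ • X i) := by
    rw [orthonormal_iff_ite]
    intro i j
    rw [inner_smul_left, inner_smul_right, hX]
    split_ifs with hij
    · subst hij
      have := h0 i
      simp; field_simp
    · simp
  let B : OrthonormalBasis (Fin 3) ℝ E3 := OrthonormalBasis.mk hon (by
    rw [hon.linearIndependent.span_eq_top_of_card_eq_finrank' (by simp)])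
  rw [← B.sum_inner_mul_inner a b]
  refine Finset.sum_congr rfl fun l _ => ?_
  have := h0 l
  simp only [B, OrthonormalBasis.coe_mk, inner_smul_right, real_inner_comm b]
  field_simp

section Realization

variable {W : Set (Fin 3 → ℝ)} {H : Fin 3 → (Fin 3 → ℝ) → ℝ} {x : (Fin 3 → ℝ) → E3}

theorem diagMetric_single (u : Fin 3 → ℝ) (i j : Fin 3) :
    diagMetric H u (Pi.single i 1) (Pi.single j 1) = if i = j then H i u ^ 2 else 0 := by
  unfold diagMetric
  rw [Finset.sum_eq_single i]
  · simp [Pi.single_apply]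
  · intro b _ hb; simp [hb]
  · simp

theorem inner_partialDeriv (hx : IsEuclideanRealization W H x) {u : Fin 3 → ℝ} (hu : u ∈ W)
    (i j : Fin 3) :
    inner ℝ (partialDeriv i x u) (partialDeriv j x u) = if i = j then H i u ^ 2 else 0 := by
  rw [← diagMetric_single]; exact hx.2 u hu _ _

theorem inner_second_same (hH : IsLameCoefficients W H) (hx : IsEuclideanRealization W H x)
    {u : Fin 3 → ℝ} (hu : u ∈ W) (i j : Fin 3) :
    inner ℝ (partialDeriv i (partialDeriv j x) u) (partialDeriv j x u) =
      H j u * partialDeriv i (H j) u := by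
  have hX := (contDiffOn_partialDeriv hH.1 hx.1 j).differentiableAt_of_isOpen hH.1 hu
  have hh := (hH.2 j).1.differentiableAt_of_isOpen hH.1 hu
  have := partialDeriv_congr hH.1 (f := fun y => inner ℝ (partialDeriv j x y) (partialDeriv j x y))
    (g := fun y => H j y * H j y) (fun y hy => by simp only [inner_partialDeriv hx hy]; simp; ring) hu i
  rw [partialDeriv_inner hX hX, partialDeriv_mul hh hh, real_inner_comm] at this
  linarith

theorem inner_second_add (hH : IsLameCoefficients W H) (hx : IsEuclideanRealization W H x)
    {u : Fin 3 → ℝ} (hu : u ∈ W) {i j : Fin 3} (hij : i ≠ j) (l : Fin 3) :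
    inner ℝ (partialDeriv l (partialDeriv i x) u) (partialDeriv j x u) +
      inner ℝ (partialDeriv l (partialDeriv j x) u) (partialDeriv i x u) = 0 := by
  have hX := fun k => (contDiffOn_partialDeriv hH.1 hx.1 k).differentiableAt_of_isOpen hH.1 hu
  have := partialDeriv_congr hH.1 (f := fun y => inner ℝ (partialDeriv i x y) (partialDeriv j x y))
    (g := fun _ => 0) (fun y hy => by simp only [inner_partialDeriv hx hy]; simp [hij]) hu l
  rw [partialDeriv_inner (hX i) (hX j), real_inner_comm] at this
  simp only [partialDeriv, fderiv_fun_const, Pi.zero_apply, zero_apply] at this ⊢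
  linarith

/-- Dupin's theorem: the coordinate curves of a triply orthogonal system are conjugate on the
coordinate surfaces, hence curvature lines. -/
theorem inner_second_distinct (hH : IsLameCoefficients W H) (hx : IsEuclideanRealization W H x)
    {u : Fin 3 → ℝ} (hu : u ∈ W) {i j k : Fin 3} (hij : i ≠ j) (hik : i ≠ k) (hjk : j ≠ k) :
    inner ℝ (partialDeriv i (partialDeriv j x) u) (partialDeriv k x u) = 0 := by
  have h1 := inner_second_add hH hx hu hjk i
  have h2 := inner_second_add hH hx hu hik j
  have h3 := inner_second_add hH hx hu hij k
  have c := partialDeriv_comm hH.1 hx.1 hu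
  rw [c i k] at h1
  rw [c j i, c j k] at h2
  linarith

theorem inner_second_diag (hH : IsLameCoefficients W H) (hx : IsEuclideanRealization W H x)
    {u : Fin 3 → ℝ} (hu : u ∈ W) {i j : Fin 3} (hij : i ≠ j) :
    inner ℝ (partialDeriv j (partialDeriv j x) u) (partialDeriv i x u) =
      -(H j u * partialDeriv i (H j) u) := by
  have h1 := inner_second_add hH hx hu hij j
  rw [partialDeriv_comm hH.1 hx.1 hu j i, inner_second_same hH hx hu] at h1
  linarith

theorem sum_of_distinct {i j k : Fin 3} (hij : i ≠ j) (hik : i ≠ k) (hjk : j ≠ k)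
    (f : Fin 3 → ℝ) : ∑ l, f l = f i + f j + f k := by
  have : (Finset.univ : Finset (Fin 3)) = {i, j, k} := by
    revert i j k; decide
  rw [this, Finset.sum_insert (by simp [hij, hik]), Finset.sum_pair hjk]; ring

/-- The Lamé equations: the vanishing of the curvature components `R_{ijkj}` with `i`, `j`, `k`
distinct. -/
theorem lame_equation (hH : IsLameCoefficients W H) (hx : IsEuclideanRealization W H x)
    {u : Fin 3 → ℝ} (hu : u ∈ W) {i j k : Fin 3} (hij : i ≠ j) (hik : i ≠ k) (hjk : j ≠ k) :
    partialDeriv k (partialDeriv i (H j)) u =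
      partialDeriv i (H j) u * partialDeriv k (H i) u / H i u +
        partialDeriv k (H j) u * partialDeriv i (H k) u / H k u := by
  have c := fun {y} (hy : y ∈ W) => partialDeriv_comm hH.1 hx.1 hy
  have s1 := contDiffOn_partialDeriv hH.1 hx.1
  have s2 := fun a b => contDiffOn_partialDeriv hH.1 (s1 a) b
  have d1 := fun a => (s1 a).differentiableAt_of_isOpen hH.1 hu
  have d2 := fun a b => (s2 a b).differentiableAt_of_isOpen hH.1 hu
  have dH := (hH.2 j).1.differentiableAt_of_isOpen hH.1 hu
  have dH' := (contDiffOn_partialDeriv hH.1 (hH.2 j).1 i).differentiableAt_of_isOpen hH.1 hu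
  -- `∂ₖ` of `⟨xᵢⱼ, xⱼ⟩ = Hⱼ ∂ᵢHⱼ`
  have e1 := partialDeriv_congr hH.1
    (f := fun y => inner ℝ (partialDeriv i (partialDeriv j x) y) (partialDeriv j x y))
    (g := fun y => H j y * partialDeriv i (H j) y) (fun y hy => inner_second_same hH hx hy i j) hu k
  rw [partialDeriv_inner (d2 j i) (d1 j), partialDeriv_mul dH dH'] at e1
  -- `∂ⱼ` of `⟨xᵢₖ, xⱼ⟩ = 0`
  have e2 := partialDeriv_congr hH.1
    (f := fun y => inner ℝ (partialDeriv i (partialDeriv k x) y) (partialDeriv j x y))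
    (g := fun y => 0) (fun y hy => inner_second_distinct hH hx hy hik hij hjk.symm) hu j
  rw [partialDeriv_inner (d2 k i) (d1 j)] at e2
  have e0 : partialDeriv j (fun _ : Fin 3 → ℝ => (0 : ℝ)) u = 0 := by simp [partialDeriv]
  rw [e0] at e2
  have e3 : partialDeriv k (partialDeriv i (partialDeriv j x)) u =
      partialDeriv j (partialDeriv i (partialDeriv k x)) u := by
    rw [partialDeriv_comm hH.1 (s1 j) hu k i, partialDeriv_comm hH.1 (s1 k) hu j i]
    exact partialDeriv_congr hH.1 (fun y hy => c hy k j) hu i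
  rw [e3] at e1
  have P := inner_eq_sum_of_orthogonal_frame (fun l => (hH.2 l).2 u hu)
    (fun a b => inner_partialDeriv hx hu a b)
  rw [P (partialDeriv i (partialDeriv j x) u), sum_of_distinct hij hik hjk,
    inner_second_same hH hx hu i j, inner_second_same hH hx hu k j,
    inner_second_distinct hH hx hu hij hik hjk,
    inner_second_distinct hH hx hu hjk.symm hik.symm hij.symm] at e1
  rw [P (partialDeriv i (partialDeriv k x) u), sum_of_distinct hij hik hjk,
    inner_second_same hH hx hu i k, inner_second_diag hH hx hu hij,
    inner_second_diag hH hx hu hjk.symm,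
    inner_second_distinct hH hx hu hik hij hjk.symm, c hu i k,
    inner_second_same hH hx hu k i] at e2
  have hi := (hH.2 i).2 u hu
  have hj := (hH.2 j).2 u hu
  have hk := (hH.2 k).2 u hu
  field_simp at e1 e2 ⊢
  have h0 : H i u * H k u * H j u ^ 3 ≠ 0 := by positivity
  refine mul_left_cancel₀ h0 ?_
  linear_combination (-H j u ^ 2) * e1 + H i u * H k u * e2

/-- The signed curvature `Hᵢ⁻¹ ∂ᵢ ln|Hⱼ|`, up to sign the principal curvature of the surfaces
`uⁱ = const` in the direction of the `j`-th coordinate curve. -/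
noncomputable def coordCurvature (H : Fin 3 → (Fin 3 → ℝ) → ℝ) (i j : Fin 3) (y : Fin 3 → ℝ) : ℝ :=
  (H i y)⁻¹ * partialDeriv i (fun z => Real.log (H j z)) y

theorem contDiffOn_coordCurvature (hH : IsLameCoefficients W H) (i j : Fin 3) :
    ContDiffOn ℝ ∞ (coordCurvature H i j) W :=
  ((hH.2 i).1.inv (hH.2 i).2).mul
    (contDiffOn_partialDeriv hH.1 ((hH.2 j).1.log (hH.2 j).2) i)

theorem coordCurvature_eq (hH : IsLameCoefficients W H) (i j : Fin 3) {u : Fin 3 → ℝ}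
    (hu : u ∈ W) :
    coordCurvature H i j u = (H i u)⁻¹ * ((H j u)⁻¹ * partialDeriv i (H j) u) := by
  rw [coordCurvature, partialDeriv_log ((hH.2 j).1.differentiableAt_of_isOpen hH.1 hu)
    ((hH.2 j).2 u hu)]

/-- The Codazzi equations of the surfaces `uⁱ = const`. In particular the derivative of a principal
curvature along the other curvature line vanishes at an umbilic. -/
theorem codazzi (hH : IsLameCoefficients W H) (hx : IsEuclideanRealization W H x)
    {u : Fin 3 → ℝ} (hu : u ∈ W) {i j k : Fin 3} (hij : i ≠ j) (hik : i ≠ k) (hjk : j ≠ k) :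
    partialDeriv k (coordCurvature H i j) u =
      partialDeriv k (H j) u / H j u * (coordCurvature H i k u - coordCurvature H i j u) := by
  have dH := fun l => (hH.2 l).1.differentiableAt_of_isOpen hH.1 hu
  have dH' := (contDiffOn_partialDeriv hH.1 (hH.2 j).1 i).differentiableAt_of_isOpen hH.1 hu
  have hi := (hH.2 i).2 u hu
  have hj := (hH.2 j).2 u hu
  have hk := (hH.2 k).2 u hu
  rw [partialDeriv_congr hH.1 (fun y hy => coordCurvature_eq hH i j hy) hu k,
    coordCurvature_eq hH i j hu, coordCurvature_eq hH i k hu,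
    partialDeriv_mul ((dH i).fun_inv hi) (((dH j).fun_inv hj).fun_mul dH'),
    partialDeriv_mul ((dH j).fun_inv hj) dH', partialDeriv_inv (dH i) hi,
    partialDeriv_inv (dH j) hj, lame_equation hH hx hu hij hik hjk]
  field_simp
  ring

end Realization

/-! ### The fundamental forms of the coordinate surfaces -/

/-- The linear inclusion of the plane of the remaining two coordinates into `ℝ³`, with `i`-th
coordinate zero. -/
noncomputable def coordInclusion (i : Fin 3) : (Fin 2 → ℝ) →L[ℝ] (Fin 3 → ℝ) :=
  ∑ m, (ContinuousLinearMap.proj m).smulRight (Pi.single (i.succAbove m) (1 : ℝ))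

theorem coordInclusion_apply (i : Fin 3) (v : Fin 2 → ℝ) :
    coordInclusion i v = ∑ m, v m • Pi.single (i.succAbove m) (1 : ℝ) := by
  simp [coordInclusion]

theorem coordInclusion_single (i : Fin 3) (m : Fin 2) :
    coordInclusion i (Pi.single m 1) = Pi.single (i.succAbove m) 1 := by
  rw [coordInclusion_apply, Finset.sum_eq_single m] <;> simp +contextual

theorem insertNth_eq_coordInclusion (i : Fin 3) (c : ℝ) (q : Fin 2 → ℝ) :
    i.insertNth (α := fun _ => ℝ) c q = coordInclusion i q + Pi.single i c := by
  rw [coordInclusion_apply]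
  ext l
  refine i.succAboveCases ?_ (fun m => ?_) l
  · simp
  · fin_cases m <;> simp

theorem diagMetric_coordInclusion (H : Fin 3 → (Fin 3 → ℝ) → ℝ) (u : Fin 3 → ℝ) (i : Fin 3)
    (v w : Fin 2 → ℝ) : diagMetric H u (coordInclusion i v) (coordInclusion i w) =
      ∑ m, H (i.succAbove m) u ^ 2 * (v m * w m) := by
  have h0 : ∀ v, coordInclusion i v i = 0 := fun v => by
    simp [coordInclusion_apply]
  have h1 : ∀ v m, coordInclusion i v (i.succAbove m) = v m := fun v m => by
    simp [coordInclusion_apply, Pi.single_apply]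
  rw [diagMetric, Fin.sum_univ_succAbove _ i]
  simp [h0, h1]

theorem hasFDerivAt_insertNth (i : Fin 3) (c : ℝ) (q : Fin 2 → ℝ) :
    HasFDerivAt (fun q : Fin 2 → ℝ => i.insertNth (α := fun _ => ℝ) c q) (coordInclusion i) q := by
  simp only [insertNth_eq_coordInclusion]
  exact (coordInclusion i).hasFDerivAt.add_const _

theorem contDiff_insertNth (i : Fin 3) (c : ℝ) :
    ContDiff ℝ ∞ (fun q : Fin 2 → ℝ => i.insertNth (α := fun _ => ℝ) c q) := by
  simp only [insertNth_eq_coordInclusion]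
  exact (coordInclusion i).contDiff.add contDiff_const

/-- The cross product as an operation on `E³`. -/
noncomputable def cross (a b : E3) : E3 :=
  WithLp.toLp 2 (crossProduct (WithLp.ofLp a) (WithLp.ofLp b))

theorem inner_cross_left (a b : E3) : inner ℝ (cross a b) a = 0 := by
  simp [cross, cross_apply, PiLp.inner_apply, Fin.sum_univ_three]; ring

theorem inner_cross_right (a b : E3) : inner ℝ (cross a b) b = 0 := by
  simp [cross, cross_apply, PiLp.inner_apply, Fin.sum_univ_three]; ring

/-- Lagrange's identity. -/
theorem norm_cross_sq (a b : E3) :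
    ‖cross a b‖ ^ 2 = inner ℝ a a * inner ℝ b b - inner ℝ a b ^ 2 := by
  rw [← real_inner_self_eq_norm_sq]
  simp only [cross, cross_apply, PiLp.inner_apply, Fin.sum_univ_three, RCLike.inner_apply,
    conj_trivial, Matrix.cons_val]
  ring

theorem continuous_cross : Continuous fun z : E3 × E3 => cross z.1 z.2 := by
  refine (PiLp.continuous_toLp 2 _).comp (continuous_pi fun l => ?_)
  fin_cases l <;> simp [cross_apply] <;> fun_prop

section Surface

variable {W : Set (Fin 3 → ℝ)} {H : Fin 3 → (Fin 3 → ℝ) → ℝ} {x : (Fin 3 → ℝ) → E3}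

theorem isOpen_coordSurfaceDomain (hW : IsOpen W) (i : Fin 3) (c : ℝ) :
    IsOpen (coordSurfaceDomain W i c) :=
  hW.preimage (contDiff_insertNth i c).continuous

theorem fderiv_coordSurface (hW : IsOpen W) (hx : ContDiffOn ℝ ∞ x W) {i : Fin 3} {c : ℝ}
    {p : Fin 2 → ℝ} (hp : p ∈ coordSurfaceDomain W i c) :
    fderiv ℝ (coordSurface x i c) p =
      (fderiv ℝ x (i.insertNth (α := fun _ => ℝ) c p)).comp (coordInclusion i) :=
  ((hx.differentiableAt_of_isOpen hW hp).hasFDerivAt.comp p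
    (hasFDerivAt_insertNth i c p)).fderiv

theorem partialDeriv_coordSurface (hW : IsOpen W) (hx : ContDiffOn ℝ ∞ x W) {i : Fin 3} {c : ℝ}
    {p : Fin 2 → ℝ} (hp : p ∈ coordSurfaceDomain W i c) (m : Fin 2) :
    partialDeriv m (coordSurface x i c) p =
      partialDeriv (i.succAbove m) x (i.insertNth (α := fun _ => ℝ) c p) := by
  simp [partialDeriv, fderiv_coordSurface hW hx hp, coordInclusion_single]

theorem fderiv_fderiv_coordSurface (hW : IsOpen W) (hx : ContDiffOn ℝ ∞ x W) {i : Fin 3} {c : ℝ}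
    {p : Fin 2 → ℝ} (hp : p ∈ coordSurfaceDomain W i c) (v w : Fin 2 → ℝ) :
    fderiv ℝ (fderiv ℝ (coordSurface x i c)) p v w =
      ∑ m, ∑ n, (v m * w n) • partialDeriv (i.succAbove m) (partialDeriv (i.succAbove n) x)
        (i.insertNth (α := fun _ => ℝ) c p) := by
  have h1 : fderiv ℝ (coordSurface x i c) =ᶠ[nhds p] fun q =>
      (fderiv ℝ x (i.insertNth (α := fun _ => ℝ) c q)).comp (coordInclusion i) :=
    Filter.eventuallyEq_of_mem ((isOpen_coordSurfaceDomain hW i c).mem_nhds hp)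
      fun q hq => fderiv_coordSurface hW hx hq
  have h2 := (((hx.fderiv_of_isOpen hW (m := ∞) (by simp)).differentiableAt_of_isOpen hW
    hp).hasFDerivAt.comp p (hasFDerivAt_insertNth i c p)).clm_comp
    (hasFDerivAt_const (coordInclusion i) p)
  rw [h1.fderiv_eq, show fderiv ℝ (fun q => (fderiv ℝ x (i.insertNth (α := fun _ => ℝ) c q)).comp
    (coordInclusion i)) p = _ from h2.fderiv]
  simp only [← fderiv_fderiv_single hW hx hp]
  simp [coordInclusion_apply, smul_smul, mul_comm]

theorem isRegularSurface_coordSurface (hH : IsLameCoefficients W H)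
    (hx : IsEuclideanRealization W H x) (i : Fin 3) (c : ℝ) :
    IsRegularSurface (coordSurfaceDomain W i c) (coordSurface x i c) := by
  refine ⟨isOpen_coordSurfaceDomain hH.1 i c,
    hx.1.comp (contDiff_insertNth i c).contDiffOn fun q hq => hq, fun p hp => ?_⟩
  rw [injective_iff_map_eq_zero]
  intro v hv
  rw [fderiv_coordSurface hH.1 hx.1 hp, ContinuousLinearMap.comp_apply] at hv
  have h := hx.2 _ hp (coordInclusion i v) (coordInclusion i v)
  rw [hv, inner_zero_left, diagMetric_coordInclusion, eq_comm,
    Finset.sum_eq_zero_iff_of_nonneg fun m _ => mul_nonneg (sq_nonneg _) (mul_self_nonneg _)] at h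
  ext m
  simpa [(hH.2 (i.succAbove m)).2 _ hp] using h m (Finset.mem_univ m)

theorem firstForm_coordSurface (hH : IsLameCoefficients W H) (hx : IsEuclideanRealization W H x)
    {i : Fin 3} {c : ℝ} {p : Fin 2 → ℝ} (hp : p ∈ coordSurfaceDomain W i c) (v w : Fin 2 → ℝ) :
    firstForm (coordSurface x i c) p v w =
      ∑ m, H (i.succAbove m) (i.insertNth (α := fun _ => ℝ) c p) ^ 2 * (v m * w m) := by
  rw [firstForm, fderiv_coordSurface hH.1 hx.1 hp, ← diagMetric_coordInclusion]
  exact hx.2 _ hp _ _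

theorem normalVector_coordSurface (hW : IsOpen W) (hx : ContDiffOn ℝ ∞ x W) {i : Fin 3} {c : ℝ}
    {p : Fin 2 → ℝ} (hp : p ∈ coordSurfaceDomain W i c) :
    normalVector (coordSurface x i c) p =
      cross (partialDeriv (i.succAbove 0) x (i.insertNth (α := fun _ => ℝ) c p))
        (partialDeriv (i.succAbove 1) x (i.insertNth (α := fun _ => ℝ) c p)) := by
  rw [normalVector, partialDeriv_coordSurface hW hx hp, partialDeriv_coordSurface hW hx hp, cross]

theorem normalVector_coordSurface_ne_zero (hH : IsLameCoefficients W H)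
    (hx : IsEuclideanRealization W H x) {i : Fin 3} {c : ℝ} {p : Fin 2 → ℝ}
    (hp : p ∈ coordSurfaceDomain W i c) : normalVector (coordSurface x i c) p ≠ 0 := by
  have h := norm_cross_sq (partialDeriv (i.succAbove 0) x (i.insertNth (α := fun _ => ℝ) c p))
    (partialDeriv (i.succAbove 1) x (i.insertNth (α := fun _ => ℝ) c p))
  rw [← normalVector_coordSurface hH.1 hx.1 hp, inner_partialDeriv hx hp, inner_partialDeriv hx hp,
    inner_partialDeriv hx hp, if_pos rfl, if_pos rfl, if_neg (by simp)] at h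
  intro h0
  have h1 := (hH.2 (i.succAbove 0)).2 _ hp
  have h2 := (hH.2 (i.succAbove 1)).2 _ hp
  rw [h0] at h
  simp [h1, h2] at h

/-- The sign relating the unit normal of the surface `uⁱ = c` to `∂ᵢx / Hᵢ`. -/
noncomputable def normalSign (H : Fin 3 → (Fin 3 → ℝ) → ℝ) (x : (Fin 3 → ℝ) → E3) (i : Fin 3)
    (c : ℝ) (p : Fin 2 → ℝ) : ℝ :=
  inner ℝ (unitNormal (coordSurface x i c) p)
    (partialDeriv i x (i.insertNth (α := fun _ => ℝ) c p)) /
      H i (i.insertNth (α := fun _ => ℝ) c p)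

theorem inner_unitNormal_partialDeriv (hW : IsOpen W) (hx : ContDiffOn ℝ ∞ x W) {i : Fin 3} {c : ℝ}
    {p : Fin 2 → ℝ} (hp : p ∈ coordSurfaceDomain W i c) (m : Fin 2) :
    inner ℝ (unitNormal (coordSurface x i c) p)
      (partialDeriv (i.succAbove m) x (i.insertNth (α := fun _ => ℝ) c p)) = 0 := by
  rw [unitNormal, inner_smul_left, normalVector_coordSurface hW hx hp]
  fin_cases m
  · exact mul_eq_zero_of_right _ (inner_cross_left _ _)
  · exact mul_eq_zero_of_right _ (inner_cross_right _ _)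

/-- The unit normal of `uⁱ = c` is `normalSign · ∂ᵢx / Hᵢ`, tested against a vector. -/
theorem inner_unitNormal (hH : IsLameCoefficients W H) (hx : IsEuclideanRealization W H x)
    {i : Fin 3} {c : ℝ} {p : Fin 2 → ℝ} (hp : p ∈ coordSurfaceDomain W i c) (z : E3) :
    inner ℝ (unitNormal (coordSurface x i c) p) z = normalSign H x i c p *
      (inner ℝ z (partialDeriv i x (i.insertNth (α := fun _ => ℝ) c p)) /
        H i (i.insertNth (α := fun _ => ℝ) c p)) := by
  rw [inner_eq_sum_of_orthogonal_frame (fun l => (hH.2 l).2 _ hp)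
    (fun a b => inner_partialDeriv hx hp a b) (unitNormal (coordSurface x i c) p),
    Fin.sum_univ_succAbove _ i]
  simp only [inner_unitNormal_partialDeriv hH.1 hx.1 hp, normalSign]
  simp
  ring

theorem normalSign_sq (hH : IsLameCoefficients W H) (hx : IsEuclideanRealization W H x)
    {i : Fin 3} {c : ℝ} {p : Fin 2 → ℝ} (hp : p ∈ coordSurfaceDomain W i c) :
    normalSign H x i c p ^ 2 = 1 := by
  have h : inner ℝ (unitNormal (coordSurface x i c) p) (unitNormal (coordSurface x i c) p) =
      (1 : ℝ) := by
    have := norm_ne_zero_iff.2 (normalVector_coordSurface_ne_zero hH hx hp)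
    rw [real_inner_self_eq_norm_sq, unitNormal, norm_smul, norm_inv, norm_norm,
      inv_mul_cancel₀ this, one_pow]
  rw [inner_unitNormal hH hx hp] at h
  rw [sq, ← h]
  rfl

theorem continuousOn_normalSign (hH : IsLameCoefficients W H) (hx : IsEuclideanRealization W H x)
    (i : Fin 3) (c : ℝ) : ContinuousOn (normalSign H x i c) (coordSurfaceDomain W i c) := by
  have hι : ContinuousOn (fun q : Fin 2 → ℝ => i.insertNth (α := fun _ => ℝ) c q)
      (coordSurfaceDomain W i c) := (contDiff_insertNth i c).continuous.continuousOn
  have hX := fun l => (contDiffOn_partialDeriv hH.1 hx.1 l).continuousOn.comp hι fun q hq => hq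
  have hN : ContinuousOn (normalVector (coordSurface x i c)) (coordSurfaceDomain W i c) :=
    (continuous_cross.comp_continuousOn ((hX (i.succAbove 0)).prodMk (hX (i.succAbove 1)))).congr
      fun q hq => normalVector_coordSurface hH.1 hx.1 hq
  refine ContinuousOn.div (ContinuousOn.inner (𝕜 := ℝ) (ContinuousOn.smul (hN.norm.inv₀ fun q hq =>
    norm_ne_zero_iff.2 (normalVector_coordSurface_ne_zero hH hx hq)) hN) (hX i))
    ((hH.2 i).1.continuousOn.comp hι fun q hq => hq) fun q hq => (hH.2 i).2 _ hq

theorem secondForm_coordSurface (hH : IsLameCoefficients W H) (hx : IsEuclideanRealization W H x)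
    {i : Fin 3} {c : ℝ} {p : Fin 2 → ℝ} (hp : p ∈ coordSurfaceDomain W i c) (v w : Fin 2 → ℝ) :
    secondForm (coordSurface x i c) p v w = -normalSign H x i c p *
      ∑ m, coordCurvature H i (i.succAbove m) (i.insertNth (α := fun _ => ℝ) c p) *
        (H (i.succAbove m) (i.insertNth (α := fun _ => ℝ) c p) ^ 2 * (v m * w m)) := by
  have h0 := (hH.2 (i.succAbove 0)).2 _ hp
  have h1 := (hH.2 (i.succAbove 1)).2 _ hp
  have hi := (hH.2 i).2 _ hp
  have n0 : i.succAbove 0 ≠ i := Fin.succAbove_ne i 0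
  have n1 : i.succAbove 1 ≠ i := Fin.succAbove_ne i 1
  have n01 : i.succAbove 0 ≠ i.succAbove 1 := by simp
  rw [secondForm, inner_unitNormal hH hx hp, fderiv_fderiv_coordSurface hH.1 hx.1 hp]
  simp only [Fin.sum_univ_two, inner_add_left, inner_smul_left]
  rw [inner_second_diag hH hx hp n0.symm, inner_second_diag hH hx hp n1.symm,
    inner_second_distinct hH hx hp n01 n0 n1, inner_second_distinct hH hx hp n01.symm n1 n0,
    coordCurvature_eq hH i _ hp, coordCurvature_eq hH i _ hp]
  simp only [conj_trivial]
  field_simp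
  ring

/-- Principal directions of `uⁱ = c`: both forms are diagonal in the coordinates. -/
theorem isPrincipalDirection_coordSurface_iff (hH : IsLameCoefficients W H)
    (hx : IsEuclideanRealization W H x) {i : Fin 3} {c : ℝ} {p : Fin 2 → ℝ}
    (hp : p ∈ coordSurfaceDomain W i c) (v : Fin 2 → ℝ) (κ : ℝ) :
    IsPrincipalDirection (coordSurface x i c) p v κ ↔ v ≠ 0 ∧ ∀ m, v m ≠ 0 →
      κ = -normalSign H x i c p *
        coordCurvature H i (i.succAbove m) (i.insertNth (α := fun _ => ℝ) c p) := by
  refine and_congr_right fun _ => ?_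
  simp only [secondForm_coordSurface hH hx hp, firstForm_coordSurface hH hx hp, Finset.mul_sum]
  constructor
  · intro h m hm
    have h' := h (Pi.single m 1)
    have hh := (hH.2 (i.succAbove m)).2 _ hp
    rw [Finset.sum_eq_single m (by simp +contextual) (by simp),
      Finset.sum_eq_single m (by simp +contextual) (by simp)] at h'
    simp only [Pi.single_eq_same, mul_one] at h'
    have : H (i.succAbove m) (i.insertNth (α := fun _ => ℝ) c p) ^ 2 * v m ≠ 0 :=
      mul_ne_zero (pow_ne_zero 2 hh) hm
    refine mul_right_cancel₀ this ?_
    rw [← h']; ring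
  · intro h w
    refine Finset.sum_congr rfl fun m _ => ?_
    by_cases hm : v m = 0
    · simp [hm]
    · rw [h m hm]; ring

/-- The sign of the normal cannot jump along a curve, so it does not affect whether a principal
curvature is constant there. -/
theorem exists_normalSign_eq_on_curve (hH : IsLameCoefficients W H)
    (hx : IsEuclideanRealization W H x) {i : Fin 3} {c : ℝ} {a b : ℝ} {γ : ℝ → Fin 2 → ℝ}
    (hγ : ContinuousOn γ (Set.Ioo a b))
    (hD : ∀ t ∈ Set.Ioo a b, γ t ∈ coordSurfaceDomain W i c) :
    ∃ ε : ℝ, ε ≠ 0 ∧ ∀ t ∈ Set.Ioo a b, normalSign H x i c (γ t) = ε := by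
  have hs : ContinuousOn (fun t => normalSign H x i c (γ t)) (Set.Ioo a b) :=
    (continuousOn_normalSign hH hx i c).comp hγ hD
  rcases isPreconnected_Ioo.eq_one_or_eq_neg_one_of_sq_eq hs
    (fun t ht => normalSign_sq hH hx (hD t ht)) with h | h
  · exact ⟨1, one_ne_zero, h⟩
  · exact ⟨-1, by norm_num, h⟩

theorem hasDerivAt_comp_insertNth {f : (Fin 3 → ℝ) → ℝ} (hW : IsOpen W)
    (hf : ContDiffOn ℝ ∞ f W) {i : Fin 3} {c : ℝ} {γ : ℝ → Fin 2 → ℝ} {t : ℝ}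
    (ht : γ t ∈ coordSurfaceDomain W i c) (hγ : DifferentiableAt ℝ γ t) :
    HasDerivAt (fun s => f (i.insertNth (α := fun _ => ℝ) c (γ s)))
      (∑ m, deriv γ t m *
        partialDeriv (i.succAbove m) f (i.insertNth (α := fun _ => ℝ) c (γ t))) t := by
  have h := (hf.differentiableAt_of_isOpen hW ht).hasFDerivAt.comp_hasDerivAt t
    ((hasFDerivAt_insertNth i c (γ t)).comp_hasDerivAt t hγ.hasDerivAt)
  refine h.congr_deriv ?_
  simp [coordInclusion_apply, partialDeriv]

/-! ### Constancy of the principal curvatures -/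

/-- If `∂ⱼ(Hᵢ⁻¹ ∂ᵢ ln|Hⱼ|) = 0`, the coordinate surfaces are Dupin cyclides. Near a parameter value
with `γ'ₘ ≠ 0`, the curvature along a curvature line `γ` is `± coordCurvature` in the direction
`m`. Its derivative has the hypothesis as its `m`-part; in the other direction `n`, the Codazzi
equation makes it a multiple of the difference of the two curvatures, and this vanishes if
`γ'ₙ ≠ 0`, since the point is then umbilic. -/
theorem isDupinCyclide_coordSurface (hH : IsLameCoefficients W H)
    (hx : IsEuclideanRealization W H x)
    (hpde : ∀ i j, i ≠ j → ∀ u ∈ W, partialDeriv j (coordCurvature H i j) u = 0)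
    (i : Fin 3) (c : ℝ) : IsDupinCyclide (coordSurfaceDomain W i c) (coordSurface x i c) := by
  refine ⟨isRegularSurface_coordSurface hH hx i c, fun a b γ κ hγ => ?_⟩
  obtain ⟨ε, hε, hs⟩ := exists_normalSign_eq_on_curve hH hx hγ.1.continuousOn
    fun t ht => (hγ.2 t ht).1
  have key : ∀ t ∈ Set.Ioo a b, deriv γ t ≠ 0 ∧ ∀ m, deriv γ t m ≠ 0 → κ t = -ε *
      coordCurvature H i (i.succAbove m) (i.insertNth (α := fun _ => ℝ) c (γ t)) := by
    intro t ht
    rw [← hs t ht]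
    exact (isPrincipalDirection_coordSurface_iff hH hx (hγ.2 t ht).1 _ _).1 (hγ.2 t ht).2
  have hκ : ∀ t ∈ Set.Ioo a b, HasDerivAt κ 0 t := by
    intro t ht
    obtain ⟨m, hm⟩ := Function.ne_iff.1 (key t ht).1
    have hD := (hγ.2 t ht).1
    have hc : ContinuousAt (fun s => deriv γ s m) t :=
      (continuous_apply m).continuousAt.comp
        (((hγ.1.deriv_of_isOpen isOpen_Ioo (m := ∞) (by simp)).continuousOn).continuousAt
          (isOpen_Ioo.mem_nhds ht))
    have hev : κ =ᶠ[nhds t] fun s => -ε *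
        coordCurvature H i (i.succAbove m) (i.insertNth (α := fun _ => ℝ) c (γ s)) := by
      filter_upwards [hc.eventually_ne hm, isOpen_Ioo.mem_nhds ht] with s h1 h2
      exact (key s h2).2 m h1
    have hd := (hasDerivAt_comp_insertNth hH.1 (contDiffOn_coordCurvature hH i (i.succAbove m)) hD
      (hγ.1.differentiableAt_of_isOpen isOpen_Ioo ht)).const_mul (-ε)
    refine (hd.congr_of_eventuallyEq hev).congr_deriv ?_
    rw [Finset.sum_eq_zero, mul_zero]
    intro n _
    by_cases hn : deriv γ t n = 0
    · simp [hn]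
    · refine mul_eq_zero_of_right _ ?_
      -- The part in the direction `n`: the hypothesis if `n = m`, the Codazzi equation if not.
      by_cases hnm : n = m
      · subst hnm
        exact hpde _ _ (Fin.succAbove_ne i n).symm _ hD
      · rw [codazzi hH hx hD (Fin.succAbove_ne i m).symm (Fin.succAbove_ne i n).symm
          (fun h => hnm (Fin.succAbove_right_injective h).symm)]
        have := ((key t ht).2 n hn).symm.trans ((key t ht).2 m hm)
        rw [mul_right_inj' (neg_ne_zero.2 hε)] at this
        rw [this, sub_self, mul_zero]
  intro s hs t ht
  exact isOpen_Ioo.is_const_of_deriv_eq_zero isPreconnected_Ioo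
    (fun r hr => (hκ r hr).differentiableAt.differentiableWithinAt)
    (fun r hr => (hκ r hr).deriv) hs ht

/-- Conversely, the coordinate curves are curvature lines of the coordinate surfaces, so the
equation `∂ⱼ(Hᵢ⁻¹ ∂ᵢ ln|Hⱼ|) = 0` expresses that the principal curvature is constant along them. -/
theorem partialDeriv_coordCurvature_eq_zero (hH : IsLameCoefficients W H)
    (hx : IsEuclideanRealization W H x)
    (hdupin : ∀ i c, IsDupinCyclide (coordSurfaceDomain W i c) (coordSurface x i c))
    {i j : Fin 3} (hij : i ≠ j) {u : Fin 3 → ℝ} (hu : u ∈ W) :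
    partialDeriv j (coordCurvature H i j) u = 0 := by
  obtain ⟨m, rfl⟩ := Fin.exists_succAbove_eq hij.symm
  set c := u i
  set q : Fin 2 → ℝ := fun n => u (i.succAbove n)
  have hq : i.insertNth (α := fun _ => ℝ) c q = u := Fin.insertNth_self_removeNth i u
  let γ : ℝ → Fin 2 → ℝ := fun t => q + t • Pi.single m 1
  have hγ0 : γ 0 = q := by simp [γ]
  have hγ' : ∀ t, HasDerivAt γ (Pi.single m 1) t := fun t => by
    have h : HasDerivAt (fun s : ℝ => s • (Pi.single m 1 : Fin 2 → ℝ)) (Pi.single m 1) t := by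
      simpa using (hasDerivAt_id t).smul_const (Pi.single m 1 : Fin 2 → ℝ)
    exact h.const_add q
  have hγs : ContDiff ℝ ∞ γ := contDiff_const.add (contDiff_id.smul contDiff_const)
  have hD0 : γ 0 ∈ coordSurfaceDomain W i c := by
    rw [hγ0]; change i.insertNth (α := fun _ => ℝ) c q ∈ W; rwa [hq]
  obtain ⟨δ, hδ, hball⟩ := Metric.isOpen_iff.1
    ((isOpen_coordSurfaceDomain hH.1 i c).preimage hγs.continuous) 0 hD0
  rw [Real.ball_eq_Ioo, zero_sub, zero_add] at hball
  obtain ⟨ε, hε, hs⟩ := exists_normalSign_eq_on_curve hH hx hγs.continuous.continuousOn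
    fun t (ht : t ∈ Set.Ioo (-δ) δ) => hball ht
  let f : ℝ → ℝ := fun t =>
    coordCurvature H i (i.succAbove m) (i.insertNth (α := fun _ => ℝ) c (γ t))
  have hcurv : IsCurvatureLine (coordSurfaceDomain W i c) (coordSurface x i c) (-δ) δ γ
      (fun t => -ε * f t) := by
    refine ⟨hγs.contDiffOn, fun t ht => ⟨hball ht, ?_⟩⟩
    rw [isPrincipalDirection_coordSurface_iff hH hx (hball ht), (hγ' t).deriv, hs t ht]
    refine ⟨by simp, fun n hn => ?_⟩
    obtain rfl : n = m := by
      by_contra h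
      exact hn (by simp [h])
    rfl
  have h0 : (0 : ℝ) ∈ Set.Ioo (-δ) δ := ⟨by linarith, hδ⟩
  have hev : f =ᶠ[nhds 0] fun _ => f 0 := by
    filter_upwards [isOpen_Ioo.mem_nhds h0] with t ht
    exact mul_left_cancel₀ (neg_ne_zero.2 hε) ((hdupin i c).2 _ _ _ _ hcurv t ht 0 h0)
  have hd := hasDerivAt_comp_insertNth hH.1 (contDiffOn_coordCurvature hH i (i.succAbove m)) hD0
    (hγ' 0).differentiableAt
  rw [(hγ' 0).deriv, Finset.sum_eq_single m (by simp +contextual) (by simp), Pi.single_eq_same,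
    one_mul, hγ0, hq] at hd
  exact hd.unique ((hasDerivAt_const (0 : ℝ) (f 0)).congr_of_eventuallyEq hev)

end Surface

theorem proposition4 (U : Set (Fin 3 → ℝ)) (H : Fin 3 → (Fin 3 → ℝ) → ℝ)
    (hH : IsLameCoefficients U H) :
    IsDupinCyclidic U H ↔
      IsFlatMetric U H ∧
        ∀ i j : Fin 3, i ≠ j → ∀ u ∈ U,
          partialDeriv j
            (fun y => (H i y)⁻¹ * partialDeriv i (fun z => Real.log (H j z)) y) u = 0 := by
  have hres : ∀ {W}, IsOpen W → W ⊆ U → IsLameCoefficients W H := fun hW hWU =>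
    ⟨hW, fun i => ⟨(hH.2 i).1.mono hWU, fun u hu => (hH.2 i).2 u (hWU hu)⟩⟩
  refine and_congr_right fun hflat => ⟨fun h i j hij u hu => ?_, fun h W x hW hWU hx i c => ?_⟩
  · obtain ⟨W, hW, huW, hWU, x, hx⟩ := hflat u hu
    exact partialDeriv_coordCurvature_eq_zero (hres hW hWU) hx (h W x hW hWU hx) hij huW
  · exact isDupinCyclide_coordSurface (hres hW hWU) hx
      (fun i j hij u hu => h i j hij u (hWU hu)) i c
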